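/- Let $K$ be a field of characteristic different from $2$ and $3$, and let $\mathbb O$ be an octonion algebra over $K$, that is, the (nonassociative, unital, $8$-dimensional) algebra $\mathbb O = \mathbb H \oplus \mathbb H\ell$ obtained by the Cayley–Dickson process with a parameter $c \in K$, $c\neq 0$, from a quaternion algebra $\mathbb H$ over $K$ with basis $1,i,j,ij$, where $i^2=a$, $j^2=b$, $ij=-ji$, $a,b\in K$, $ab\ne 0$; explicitly, $(p+q\ell)(r+s\ell) = (pr + c\,\overline{s}q) + (sp + q\overline{r})\ell$, with conjugation $\overline{p+q\ell} = \overline p - q\ell$. (The split octonion algebra is the one with $c = 1$ and arbitrary nonzero $a,b$; the algebra with a standard basis $1,e_1,\dots,e_7$, $e_i^2=-1$, $e_ie_j=-e_je_i$ for $i\neq j$, is the one with $a=b=c=-1$.) For $n\ge 0$ let $J$ be the involution $(a_{ij})\mapsto(\overline{a_{ji}})$ of the algebra $M_n(\mathbb O)$ of $n\times n$ matrices over $\mathbb O$. Let $\mathrm{Sym}^+ = \{X : J(X)=X\}$ be the algebra of Hermitian matrices with the product $X\circ Y=\frac12(XY+YX)$, and let $\mathrm{Sym}^-=\{X : J(X)=-X\}$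 be the algebra of skew-Hermitian matrices with the product $[X,Y]=XY-YX$. For a matrix $X = (a_{ij})$ write $\overline X=(\overline{a_{ij}})$. A symmetric bilinear form $\varphi: A\times A\to K$ on an algebra $A$ is called associative if $\varphi(xy,z)=\varphi(x,yz)$ for all $x,y,z\in A$, where $xy$ denotes the product of the algebra $A$. Let $A$ be either of the algebras $\mathrm{Sym}^+$, $\mathrm{Sym}^-$. Then $$ (X,Y)\mapsto \mathrm{Tr}\bigl(XY+\overline{XY}\bigr), $$ where $XY$ is the product in $M_n(\mathbb O)$, takes values in $K = K1\subseteq\mathbb O$ and is a symmetric bilinear associative form on $A$, and any symmetric bilinear associative form $A\times A\to K$ is a scalar multiple of it. -/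

import Mathlib

/-! The reduced trace of the octonions satisfies `tr (x y) = tr (y x)` and
`tr ((x y) z) = tr (x (y z))`. Both identities pass to `Tr (X Y + \overline{X Y})` on all matrices,
and make it associative for the Jordan product and for the commutator.

For uniqueness put `e = Eₖₖ` in the Hermitian and `e = i Eₖₖ` in the skew-Hermitian case. The trace
form does not vanish at `(e, e)`, so by subtracting a multiple of it one only has to show that a
symmetric associative form `φ` with `φ e e = 0` is zero. Multiplication by diagonal matrices makes
the span of the `x Eₗₘ ± x̄ Eₘₗ` orthogonal to the one of every other pair of positions, and
associativity expresses `φ` on an off-diagonal block `{l, m}` through the diagonal block `l` as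
well as through `m`; thus the values of `φ` are carried from position `k` to all others. A diagonal
Hermitian block is one-dimensional. A diagonal skew-Hermitian block consists of the imaginary
octonions, where `[i, [i, x]] = 4 a (x - Re x - t i)`, with `t` the `i`-coordinate of `x`, recovers
the form from its value at `(i, i)`.
-/

open scoped Quaternion

/-- The octonion algebra over `K` with nonzero parameters `a`, `b`, `c`: the Cayley-Dickson double
`ℍ ⊕ ℍ l`, `l ^ 2 = c`, of the quaternion algebra `ℍ = ℍ[K,a,b]` with `i ^ 2 = a`, `j ^ 2 = b`,
`i * j = - j * i`. The element `p + q l` is stored as the pair `(p, q)`. In characteristic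
different from 2, with `a`, `b`, `c` ranging over the nonzero elements of `K`, these are exactly
the octonion algebras over `K` up to isomorphism; the split one is obtained for `c = 1` (and any
nonzero `a`, `b`), and the one with a basis `1, e₁, …, e₇` of pairwise anticommuting `eᵢ` with
`eᵢ ^ 2 = -1` is obtained for `a = b = c = -1`. -/
def OctonionAlgebra (K : Type*) [CommRing K] (a b _c : K) : Type _ := ℍ[K,a,b] × ℍ[K,a,b]

namespace OctonionAlgebra

variable {K : Type*} [CommRing K] {a b c : K}

instance : AddCommGroup (OctonionAlgebra K a b c) :=
  inferInstanceAs (AddCommGroup (ℍ[K,a,b] × ℍ[K,a,b]))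

instance : Module K (OctonionAlgebra K a b c) :=
  inferInstanceAs (Module K (ℍ[K,a,b] × ℍ[K,a,b]))

/-- The unit `1 = 1 + 0 l`. -/
instance : One (OctonionAlgebra K a b c) := ⟨((1, 0) : ℍ[K,a,b] × ℍ[K,a,b])⟩

/-- `(p + q l) (r + s l) = (p r + c s̄ q) + (s p + q r̄) l`. -/
instance : Mul (OctonionAlgebra K a b c) :=
  ⟨fun x y => ((x.1 * y.1 + c • (star y.2 * x.2), y.2 * x.1 + x.2 * star y.1) :
    ℍ[K,a,b] × ℍ[K,a,b])⟩

/-- The standard conjugation `p + q l ↦ p̄ - q l`. -/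
instance : Star (OctonionAlgebra K a b c) :=
  ⟨fun x => ((star x.1, -x.2) : ℍ[K,a,b] × ℍ[K,a,b])⟩

@[ext] theorem ext {x y : OctonionAlgebra K a b c} (h₁ : x.1 = y.1) (h₂ : x.2 = y.2) : x = y :=
  Prod.ext h₁ h₂

@[simp] theorem fst_zero : (0 : OctonionAlgebra K a b c).1 = 0 := rfl
@[simp] theorem snd_zero : (0 : OctonionAlgebra K a b c).2 = 0 := rfl
@[simp] theorem fst_one : (1 : OctonionAlgebra K a b c).1 = 1 := rfl
@[simp] theorem snd_one : (1 : OctonionAlgebra K a b c).2 = 0 := rfl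
@[simp] theorem fst_add (x y : OctonionAlgebra K a b c) : (x + y).1 = x.1 + y.1 := rfl
@[simp] theorem snd_add (x y : OctonionAlgebra K a b c) : (x + y).2 = x.2 + y.2 := rfl
@[simp] theorem fst_smul (t : K) (x : OctonionAlgebra K a b c) : (t • x).1 = t • x.1 := rfl
@[simp] theorem snd_smul (t : K) (x : OctonionAlgebra K a b c) : (t • x).2 = t • x.2 := rfl
@[simp] theorem fst_mul (x y : OctonionAlgebra K a b c) :
    (x * y).1 = x.1 * y.1 + c • (star y.2 * x.2) := rfl
@[simp] theorem snd_mul (x y : OctonionAlgebra K a b c) :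
    (x * y).2 = y.2 * x.1 + x.2 * star y.1 := rfl
@[simp] theorem fst_star (x : OctonionAlgebra K a b c) : (star x).1 = star x.1 := rfl
@[simp] theorem snd_star (x : OctonionAlgebra K a b c) : (star x).2 = -x.2 := rfl

instance : NonAssocRing (OctonionAlgebra K a b c) :=
  { (inferInstance : AddCommGroup (OctonionAlgebra K a b c)),
    (inferInstance : Mul (OctonionAlgebra K a b c)),
    (inferInstance : One (OctonionAlgebra K a b c)) with
    left_distrib := fun x y z => by
      ext1 <;> simp [mul_add, add_mul, smul_add] <;> abel
    right_distrib := fun x y z => by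
      ext1 <;> simp [mul_add, add_mul, smul_add] <;> abel
    zero_mul := fun x => by ext1 <;> simp
    mul_zero := fun x => by ext1 <;> simp
    one_mul := fun x => by ext1 <;> simp
    mul_one := fun x => by ext1 <;> simp }

theorem star_smul' (t : K) (x : OctonionAlgebra K a b c) : star (t • x) = t • star x := by
  ext1
  · simp [QuaternionAlgebra.star_smul]
  · simp

instance : StarRing (OctonionAlgebra K a b c) where
  star_involutive x := by ext1 <;> simp
  star_add x y := by ext1 <;> simp [add_comm]
  star_mul x y := by
    ext1
    · simp [QuaternionAlgebra.star_smul]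
    · simp [add_comm]

end OctonionAlgebra

section MatrixAlgebras

variable (K : Type*) [Field K] (a b c : K) (n : ℕ)

/-- The `n × n` matrices over the octonion algebra. The star on matrices, `Xᴴ`, is
`(xᵢⱼ) ↦ (x̄ⱼᵢ)`, that is, the involution `J`. -/
abbrev OctonionMatrix : Type _ := Matrix (Fin n) (Fin n) (OctonionAlgebra K a b c)

variable {K a b c n} in
theorem OctonionMatrix.conjTranspose_smul' (t : K) (X : OctonionMatrix K a b c n) :
    (t • X).conjTranspose = t • X.conjTranspose :=
  Matrix.ext fun i j => OctonionAlgebra.star_smul' t (X j i)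

/-- The space of Hermitian octonionic matrices, `Sym⁺(Mₙ(𝕆), J)`. -/
def hermitianOct : Submodule K (OctonionMatrix K a b c n) where
  carrier := {X | X.conjTranspose = X}
  add_mem' {X Y} hX hY := by
    simp only [Set.mem_ofPred_eq] at *
    rw [Matrix.conjTranspose_add, hX, hY]
  zero_mem' := Matrix.conjTranspose_zero
  smul_mem' t X hX := by
    simp only [Set.mem_ofPred_eq] at *
    rw [OctonionMatrix.conjTranspose_smul', hX]

/-- The space of skew-Hermitian octonionic matrices, `Sym⁻(Mₙ(𝕆), J)`. -/
def skewHermitianOct : Submodule K (OctonionMatrix K a b c n) where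
  carrier := {X | X.conjTranspose = -X}
  add_mem' {X Y} hX hY := by
    simp only [Set.mem_ofPred_eq] at *
    rw [Matrix.conjTranspose_add, hX, hY, neg_add]
  zero_mem' := by simp
  smul_mem' t X hX := by
    simp only [Set.mem_ofPred_eq] at *
    rw [OctonionMatrix.conjTranspose_smul', hX, smul_neg]

variable {K a b c n}

/-- The algebra of Hermitian matrices: the product is `X ∘ Y = ½ (X Y + Y X)`. -/
instance : Mul (hermitianOct K a b c n) where
  mul X Y := ⟨(2 : K)⁻¹ • (X.1 * Y.1 + Y.1 * X.1), by
    refine Submodule.smul_mem _ _ ?_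
    have hX : (X : OctonionMatrix K a b c n).conjTranspose = X := X.2
    have hY : (Y : OctonionMatrix K a b c n).conjTranspose = Y := Y.2
    change Matrix.conjTranspose _ = _
    rw [Matrix.conjTranspose_add, Matrix.conjTranspose_mul, Matrix.conjTranspose_mul, hX, hY,
      add_comm]⟩

/-- The algebra of skew-Hermitian matrices: the product is `[X, Y] = X Y - Y X`. -/
instance : Mul (skewHermitianOct K a b c n) where
  mul X Y := ⟨X.1 * Y.1 - Y.1 * X.1, by
    have hX : (X : OctonionMatrix K a b c n).conjTranspose = -X := X.2
    have hY : (Y : OctonionMatrix K a b c n).conjTranspose = -Y := Y.2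
    change Matrix.conjTranspose _ = _
    rw [Matrix.conjTranspose_sub, Matrix.conjTranspose_mul, Matrix.conjTranspose_mul, hX, hY,
      neg_mul_neg, neg_mul_neg, neg_sub]⟩

/-- The entrywise conjugate `X̄ = (x̄ᵢⱼ)`. -/
def OctonionMatrix.conj (X : OctonionMatrix K a b c n) : OctonionMatrix K a b c n :=
  X.map star

/-- The octonion `Tr(X Y + \overline{X Y})`, which is a scalar (a multiple of `1`). -/
def OctonionMatrix.traceForm (X Y : OctonionMatrix K a b c n) : OctonionAlgebra K a b c :=
  Matrix.trace (X * Y + OctonionMatrix.conj (X * Y))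

end MatrixAlgebras

/-- `φ` is a symmetric associative form: `φ(x, y) = φ(y, x)` and `φ(x y, z) = φ(x, y z)`. -/
def IsSymmAssocForm {K A : Type*} [Field K] [AddCommGroup A] [Module K A] [Mul A]
    (φ : LinearMap.BilinForm K A) : Prop :=
  (∀ x y, φ x y = φ y x) ∧ ∀ x y z, φ (x * y) z = φ x (y * z)

section AssociativeForms

/-- The bilinear form `(x, y) ↦ τ (x y)` attached to a linear functional `τ` on a nonassociative
algebra. -/
def mulForm {K A : Type*} [CommSemiring K] [NonUnitalNonAssocSemiring A] [Module K A]
    [SMulCommClass K A A] [IsScalarTower K A A] (τ : A →ₗ[K] K) : LinearMap.BilinForm K A :=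
  (LinearMap.mul K A).compr₂ τ

variable {K A : Type*} [Field K]

theorem IsSymmAssocForm.mulForm_trace {m : Type*} [Fintype m] [NonUnitalNonAssocRing A]
    [Module K A] [SMulCommClass K A A] [IsScalarTower K A A] {τ : A →ₗ[K] K}
    (hτ : IsSymmAssocForm (mulForm τ)) :
    IsSymmAssocForm (mulForm (τ ∘ₗ Matrix.traceLinearMap m K A)) := by
  have hcomm (x y : A) : τ (x * y) = τ (y * x) := hτ.1 x y
  have hassoc (x y z : A) : τ (x * y * z) = τ (x * (y * z)) := hτ.2 x y z
  constructor
  · intro X Y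
    change τ (Matrix.trace (X * Y)) = τ (Matrix.trace (Y * X))
    simp only [Matrix.trace, Matrix.diag_apply, Matrix.mul_apply, map_sum, hcomm]
    exact Finset.sum_comm
  · intro X Y Z
    change τ (Matrix.trace (X * Y * Z)) = τ (Matrix.trace (X * (Y * Z)))
    simp only [Matrix.trace, Matrix.diag_apply, Matrix.mul_apply, map_sum, Finset.sum_mul,
      Finset.mul_sum, hassoc]
    exact Finset.sum_congr rfl fun _ _ => Finset.sum_comm

theorem IsSymmAssocForm.restrict_of_coe_mul [NonUnitalNonAssocRing A] [Module K A]
    {φ : LinearMap.BilinForm K A} (hφ : IsSymmAssocForm φ) (S : Submodule K A) [Mul S] (s t : K)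
    (hmul : ∀ X Y : S, ((X * Y : S) : A) = s • (X * Y : A) + t • (Y * X : A)) :
    IsSymmAssocForm (φ.restrict S) := by
  obtain ⟨hsymm, hassoc⟩ := hφ
  have hrot (x y z : A) : φ (y * x) z = φ x (z * y) := by rw [hassoc, hsymm, hassoc]
  refine ⟨fun X Y => hsymm X Y, fun X Y Z => ?_⟩
  simp only [LinearMap.BilinForm.restrict_apply, LinearMap.domRestrict_apply, hmul, map_add,
    map_smul, LinearMap.add_apply, LinearMap.smul_apply, hassoc X.1, hrot X.1]

variable [AddCommGroup A] [Module K A]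

theorem IsSymmAssocForm.sub_smul [Mul A] {φ ψ : LinearMap.BilinForm K A}
    (hφ : IsSymmAssocForm φ) (hψ : IsSymmAssocForm ψ) (t : K) : IsSymmAssocForm (φ - t • ψ) :=
  ⟨fun x y => by simp [hφ.1 x y, hψ.1 x y], fun x y z => by simp [hφ.2 x y z, hψ.2 x y z]⟩

theorem IsSymmAssocForm.exists_eq_smul [Mul A] {φ ψ : LinearMap.BilinForm K A}
    (hφ : IsSymmAssocForm φ) (hψ : IsSymmAssocForm ψ) {e : A} (he : ψ e e ≠ 0)
    (h : ∀ χ : LinearMap.BilinForm K A, IsSymmAssocForm χ → χ e e = 0 → χ = 0) :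
    ∃ t : K, φ = t • ψ :=
  ⟨φ e e / ψ e e, sub_eq_zero.1 <| h _ (hφ.sub_smul hψ _) (by simp [he])⟩

variable {ι V : Type*} [AddCommGroup V] [Module K V] {s : ι → ι → V →ₗ[K] A}

theorem linearMap_eq_zero_of_iSup_range {M : Type*} [AddCommGroup M] [Module K M]
    (hs : ⨆ i, ⨆ j, LinearMap.range (s i j) = ⊤) {f : A →ₗ[K] M}
    (hf : ∀ i j x, f (s i j x) = 0) : f = 0 :=
  LinearMap.ker_eq_top.1 <| top_le_iff.1 <| hs ▸ iSup₂_le fun i j =>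
    LinearMap.range_le_ker_iff.2 <| LinearMap.ext <| hf i j

/-- Unless `{i, j} = {k, l}`, one of the four indices occurs in only one of the two pairs. -/
theorem bilinForm_eq_zero_of_blocks (hs : ⨆ i, ⨆ j, LinearMap.range (s i j) = ⊤)
    (hswap : ∀ i j x, ∃ y, s i j x = s j i y) {φ : LinearMap.BilinForm K A}
    (hsymm : ∀ X Y, φ X Y = φ Y X)
    (hne : ∀ {i k l}, i ≠ k → i ≠ l → ∀ j x y, φ (s i j x) (s k l y) = 0)
    (hself : ∀ i j x y, φ (s i j x) (s i j y) = 0) : φ = 0 := by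
  have hne' {i k l} (hik : i ≠ k) (hil : i ≠ l) (j x y) : φ (s j i x) (s k l y) = 0 := by
    obtain ⟨x', hx'⟩ := hswap j i x
    rw [hx', hne hik hil]
  refine linearMap_eq_zero_of_iSup_range hs fun i j x =>
    linearMap_eq_zero_of_iSup_range hs fun k l y => ?_
  by_cases hi : i ≠ k ∧ i ≠ l
  · exact hne hi.1 hi.2 j x y
  by_cases hj : j ≠ k ∧ j ≠ l
  · exact hne' hj.1 hj.2 i x y
  by_cases hk : k ≠ i ∧ k ≠ j
  · rw [hsymm, hne hk.1 hk.2]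
  by_cases hl : l ≠ i ∧ l ≠ j
  · rw [hsymm, hne' hl.1 hl.2]
  obtain ⟨rfl, rfl⟩ | ⟨rfl, rfl⟩ : (i = k ∧ j = l) ∨ (i = l ∧ j = k) := by grind
  · exact hself i j x y
  · obtain ⟨y', hy'⟩ := hswap j i y
    rw [hy', hself]

end AssociativeForms

theorem matrixSingle_sub {R m n : Type*} [AddCommGroup R] [DecidableEq m] [DecidableEq n] (i : m)
    (j : n) (x y : R) :
    Matrix.single i j (x - y) = Matrix.single i j x - Matrix.single i j y :=
  map_sub (Matrix.singleAddMonoidHom i j) x y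

theorem conjTranspose_eq_sum_single {R m : Type*} [AddCommMonoid R] [StarAddMonoid R] [Fintype m]
    [DecidableEq m] (X : Matrix m m R) :
    X.conjTranspose = ∑ i, ∑ j, Matrix.single j i (star (X i j)) := by
  conv_lhs => rw [Matrix.matrix_eq_sum_single X]
  simp only [Matrix.conjTranspose_sum, Matrix.conjTranspose_single]

namespace OctonionAlgebra

section CommRing

open QuaternionAlgebra

variable {K : Type*} [CommRing K] {a b c : K}

instance : IsScalarTower K (OctonionAlgebra K a b c) (OctonionAlgebra K a b c) where
  smul_assoc t x y := by
    ext1 <;> simp [smul_add, smul_comm c t]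

instance : SMulCommClass K (OctonionAlgebra K a b c) (OctonionAlgebra K a b c) where
  smul_comm t x y := by
    ext1 <;> simp [smul_add, smul_comm c t, QuaternionAlgebra.star_smul]

@[simp] theorem fst_neg (x : OctonionAlgebra K a b c) : (-x).1 = -x.1 := rfl
@[simp] theorem snd_neg (x : OctonionAlgebra K a b c) : (-x).2 = -x.2 := rfl

@[simp] theorem fst_sub (x y : OctonionAlgebra K a b c) : (x - y).1 = x.1 - y.1 := by
  rw [sub_eq_add_neg, fst_add, fst_neg, sub_eq_add_neg]

@[simp] theorem snd_sub (x y : OctonionAlgebra K a b c) : (x - y).2 = x.2 - y.2 := by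
  rw [sub_eq_add_neg, snd_add, snd_neg, sub_eq_add_neg]

/-- The reduced trace `x + x̄` of an octonion, as a scalar. -/
def tr : OctonionAlgebra K a b c →ₗ[K] K where
  toFun x := 2 * x.1.re
  map_add' x y := by simp [mul_add]
  map_smul' t x := by simp [mul_left_comm]

theorem tr_apply (x : OctonionAlgebra K a b c) : tr x = 2 * x.1.re := rfl

theorem tr_smul_one (x : OctonionAlgebra K a b c) :
    tr x • (1 : OctonionAlgebra K a b c) = x + star x := by
  ext <;> simp [tr_apply, two_mul]

theorem tr_mul_comm (x y : OctonionAlgebra K a b c) : tr (x * y) = tr (y * x) := by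
  simp only [tr_apply, fst_mul, re_add, re_mul, re_smul, re_star, imI_star, imJ_star, imK_star,
    smul_eq_mul]
  ring

theorem tr_mul_assoc (x y z : OctonionAlgebra K a b c) : tr (x * y * z) = tr (x * (y * z)) := by
  simp only [tr_apply, fst_mul, snd_mul, re_add, re_mul, re_smul, re_star, imI_add, imI_mul,
    imI_smul, imI_star, imJ_add, imJ_mul, imJ_smul, imJ_star, imK_add, imK_mul, imK_smul, imK_star,
    star_add, star_mul, smul_eq_mul]
  ring

theorem add_star_eq_smul_one_add_one (x : OctonionAlgebra K a b c) :
    x + star x = x.1.re • (1 + 1 : OctonionAlgebra K a b c) := by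
  rw [← tr_smul_one, tr_apply, ← two_smul K, smul_smul, mul_comm]

theorem lie_sub_star_sub_star (x y : OctonionAlgebra K a b c) :
    ⁅x - star x, y - star y⁆ = (2 : K) • (⁅x, y⁆ - star ⁅x, y⁆) := by
  have hx : star x = tr x • 1 - x := eq_sub_of_add_eq' (tr_smul_one x).symm
  have hy : star y = tr y • 1 - y := eq_sub_of_add_eq' (tr_smul_one y).symm
  simp only [Ring.lie_def, star_sub, star_mul, hx, hy, sub_mul, mul_sub, smul_mul_assoc,
    mul_smul_comm, one_mul, mul_one]
  module

variable (K a b c) in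
/-- The imaginary unit `i` of the quaternion algebra, as an octonion. -/
def imI : OctonionAlgebra K a b c := ((⟨0, 1, 0, 0⟩, 0) : ℍ[K,a,b] × ℍ[K,a,b])

variable (K a b c) in
/-- The imaginary unit `j` of the quaternion algebra, as an octonion. -/
def imJ : OctonionAlgebra K a b c := ((⟨0, 0, 1, 0⟩, 0) : ℍ[K,a,b] × ℍ[K,a,b])

variable (K a b c) in
/-- The imaginary unit `i j` of the quaternion algebra, as an octonion. -/
def imK : OctonionAlgebra K a b c := ((⟨0, 0, 0, 1⟩, 0) : ℍ[K,a,b] × ℍ[K,a,b])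

@[simp] theorem fst_imI : (imI K a b c).1 = ⟨0, 1, 0, 0⟩ := rfl
@[simp] theorem snd_imI : (imI K a b c).2 = 0 := rfl
@[simp] theorem fst_imJ : (imJ K a b c).1 = ⟨0, 0, 1, 0⟩ := rfl
@[simp] theorem snd_imJ : (imJ K a b c).2 = 0 := rfl
@[simp] theorem fst_imK : (imK K a b c).1 = ⟨0, 0, 0, 1⟩ := rfl
@[simp] theorem snd_imK : (imK K a b c).2 = 0 := rfl

theorem imI_sub_star_imI : imI K a b c - star (imI K a b c) = (2 : K) • imI K a b c := by
  ext <;> simp [one_add_one_eq_two]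

theorem imI_mul_imI_mul (x : OctonionAlgebra K a b c) :
    imI K a b c * (imI K a b c * x) = a • x := by
  ext <;> simp

theorem lie_imJ_imK : ⁅imJ K a b c, imK K a b c⁆ = (-2 * b) • imI K a b c := by
  rw [Ring.lie_def]
  ext <;> simp [neg_sub_left, ← two_mul]

theorem lie_imI_lie_imI (x : OctonionAlgebra K a b c) :
    ⁅imI K a b c, ⁅imI K a b c, x⁆⁆ =
      (2 ^ 2 * a) • (x - x.1.re • (1 : OctonionAlgebra K a b c) - x.1.imI • imI K a b c) := by
  simp only [Ring.lie_def]
  ext <;> simp <;> ring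

end CommRing

section Field

variable {K : Type*} [Field K] {a b c : K}

theorem isSymmAssocForm_mulForm_tr :
    IsSymmAssocForm (mulForm (tr : OctonionAlgebra K a b c →ₗ[K] K)) :=
  ⟨tr_mul_comm, tr_mul_assoc⟩

variable [NeZero (2 : K)]

theorem linearMap_eq_zero_of_lie (ha : a ≠ 0) (hb : b ≠ 0) {M : Type*} [AddCommGroup M]
    [Module K M] {f : OctonionAlgebra K a b c →ₗ[K] M} (h1 : f 1 = 0)
    (hlie : ∀ x y : OctonionAlgebra K a b c, f ⁅x, y⁆ = 0) : f = 0 := by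
  have hI : f (imI K a b c) = 0 := by
    have h := hlie (imJ K a b c) (imK K a b c)
    rw [lie_imJ_imK, map_smul] at h
    simpa [hb, two_ne_zero] using h
  ext x
  have h := hlie (imI K a b c) ⁅imI K a b c, x⁆
  rw [lie_imI_lie_imI] at h
  simpa [h1, hI, ha, two_ne_zero] using h

theorem bilinForm_eq_zero_of_lie (ha : a ≠ 0)
    {ψ : LinearMap.BilinForm K (OctonionAlgebra K a b c)} (hsymm : ∀ x y, ψ x y = ψ y x)
    (hlie : ∀ x y z, ψ ⁅x, y⁆ z = ψ x ⁅y, z⁆) (h1 : ∀ y, ψ 1 y = 0)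
    (hI : ψ (imI K a b c) (imI K a b c) = 0) : ψ = 0 := by
  have hI_left (y : OctonionAlgebra K a b c) : ψ (imI K a b c) y = 0 := by
    have h := hlie (imI K a b c) (imI K a b c) ⁅imI K a b c, y⁆
    rw [lie_imI_lie_imI, Ring.lie_def, sub_self] at h
    simpa [hsymm _ 1, h1, hI, ha, two_ne_zero] using h.symm
  ext x y
  have h := hlie (imI K a b c) ⁅imI K a b c, x⁆ y
  rw [lie_imI_lie_imI, hI_left] at h
  simpa [h1, hI_left, ha, two_ne_zero] using h

end Field

end OctonionAlgebra

open Matrix OctonionAlgebra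

namespace OctonionMatrix

variable (K : Type*) [Field K] (a b c : K) (n : ℕ)

/-- The form `(X, Y) ↦ Tr(X Y + \overline{X Y})` of `OctonionMatrix.traceForm`, as a bilinear form
with values in `K`. -/
def traceBilinForm : LinearMap.BilinForm K (OctonionMatrix K a b c n) :=
  mulForm (tr ∘ₗ traceLinearMap (Fin n) K (OctonionAlgebra K a b c))

variable {K a b c n}

theorem traceBilinForm_apply (X Y : OctonionMatrix K a b c n) :
    traceBilinForm K a b c n X Y = tr (trace (X * Y)) := rfl

theorem traceBilinForm_smul_one (X Y : OctonionMatrix K a b c n) :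
    traceBilinForm K a b c n X Y • (1 : OctonionAlgebra K a b c) = traceForm X Y := by
  rw [traceBilinForm_apply, tr_smul_one, traceForm, trace_add]
  congr 1
  simp only [trace, diag_apply, OctonionMatrix.conj, map_apply, star_sum]

theorem isSymmAssocForm_traceBilinForm : IsSymmAssocForm (traceBilinForm K a b c n) :=
  isSymmAssocForm_mulForm_tr.mulForm_trace

end OctonionMatrix

open OctonionMatrix

namespace hermitianOct

variable {K : Type*} [Field K] {a b c : K} {n : ℕ}

theorem coe_mul (X Y : hermitianOct K a b c n) :
    ((X * Y : hermitianOct K a b c n) : OctonionMatrix K a b c n) =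
      (2 : K)⁻¹ • (X.1 * Y.1 + Y.1 * X.1) := rfl

theorem jordan_comm (X Y : hermitianOct K a b c n) : X * Y = Y * X :=
  Subtype.ext <| by rw [coe_mul, coe_mul, add_comm]

theorem isSymmAssocForm_traceBilinForm :
    IsSymmAssocForm ((traceBilinForm K a b c n).restrict (hermitianOct K a b c n)) :=
  OctonionMatrix.isSymmAssocForm_traceBilinForm.restrict_of_coe_mul _ 2⁻¹ 2⁻¹ fun X Y => by
    rw [coe_mul, smul_add]

/-- The Hermitian matrix `x Eᵢⱼ + x̄ Eⱼᵢ`. For `i = j` this is `(x + x̄) Eᵢᵢ`, so that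
`symmSingle i i 1` is twice the idempotent `Eᵢᵢ`. -/
def symmSingle (i j : Fin n) : OctonionAlgebra K a b c →ₗ[K] hermitianOct K a b c n where
  toFun x := ⟨single i j x + single j i (star x), by
    change conjTranspose _ = _
    rw [conjTranspose_add, conjTranspose_single, conjTranspose_single, star_star, add_comm]⟩
  map_add' x y := Subtype.ext <| by
    simp only [single_add, star_add, AddMemClass.mk_add_mk]
    abel
  map_smul' t x := Subtype.ext <| by
    simp [star_smul', smul_single]

theorem coe_symmSingle (i j : Fin n) (x : OctonionAlgebra K a b c) :
    (symmSingle i j x : OctonionMatrix K a b c n) = single i j x + single j i (star x) := rfl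

theorem symmSingle_swap (i j : Fin n) (x : OctonionAlgebra K a b c) :
    symmSingle i j x = symmSingle j i (star x) :=
  Subtype.ext <| by rw [coe_symmSingle, coe_symmSingle, star_star, add_comm]

theorem symmSingle_self (i : Fin n) (x : OctonionAlgebra K a b c) :
    symmSingle i i x = x.1.re • symmSingle i i (1 : OctonionAlgebra K a b c) :=
  Subtype.ext <| by
    rw [coe_symmSingle, Submodule.coe_smul, coe_symmSingle, ← single_add, ← single_add, star_one,
      smul_single, add_star_eq_smul_one_add_one]

theorem sum_symmSingle (X : hermitianOct K a b c n) :
    ∑ i, ∑ j, symmSingle i j (X.1 i j) = (2 : K) • X := by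
  have hX : X.1.conjTranspose = X.1 := X.2
  refine Subtype.ext ?_
  simp only [Submodule.coe_smul, Submodule.coe_sum, coe_symmSingle, Finset.sum_add_distrib]
  rw [← conjTranspose_eq_sum_single, ← matrix_eq_sum_single, hX, two_smul]

theorem symmSingle_mul_symmSingle_of_ne {i j : Fin n} (hij : i ≠ j)
    (x y : OctonionAlgebra K a b c) :
    symmSingle i j x * symmSingle i j y =
      (2 : K)⁻¹ • (symmSingle i i (x * star y) + symmSingle j j (star x * y)) := by
  refine Subtype.ext ?_
  simp only [coe_mul, coe_symmSingle, mul_add, add_mul, ne_eq, hij, hij.symm, not_false_eq_true,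
    single_mul_single_of_ne, single_mul_single_same, zero_add, add_zero, Submodule.coe_smul,
    Submodule.coe_add, star_mul, star_star]
  module

theorem diag_one_mul_of_ne {i k l : Fin n} (hik : i ≠ k) (hil : i ≠ l)
    (x : OctonionAlgebra K a b c) : symmSingle i i 1 * symmSingle k l x = 0 := by
  refine Subtype.ext ?_
  simp [coe_mul, coe_symmSingle, add_mul, mul_add, hik, hil, hik.symm, hil.symm]

theorem traceBilinForm_diag_one (i : Fin n) :
    (traceBilinForm K a b c n).restrict (hermitianOct K a b c n) (symmSingle i i 1)
      (symmSingle i i 1) = 2 ^ 3 := by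
  rw [LinearMap.BilinForm.restrict_apply, LinearMap.domRestrict_apply, traceBilinForm_apply,
    coe_symmSingle, ← single_add, single_mul_single_same, trace_single_eq_same, tr_apply]
  simp only [star_one, mul_add, mul_one, fst_add, fst_one, QuaternionAlgebra.re_add,
    QuaternionAlgebra.re_one]
  norm_num

variable [NeZero (2 : K)]

theorem iSup_range_symmSingle :
    ⨆ i, ⨆ j, LinearMap.range
      (symmSingle i j : OctonionAlgebra K a b c →ₗ[K] hermitianOct K a b c n) = ⊤ := by
  refine eq_top_iff.2 fun X _ => ?_
  rw [← inv_smul_smul₀ (two_ne_zero' K) X, ← sum_symmSingle]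
  exact Submodule.smul_mem _ _ <| Submodule.sum_mem _ fun i _ => Submodule.sum_mem _ fun j _ =>
    Submodule.mem_iSup_of_mem i <| Submodule.mem_iSup_of_mem j ⟨_, rfl⟩

theorem diag_one_mul_diag (i : Fin n) (x : OctonionAlgebra K a b c) :
    symmSingle i i 1 * symmSingle i i x = (2 : K) • symmSingle i i x := by
  refine Subtype.ext ?_
  rw [coe_mul, inv_smul_eq_iff₀ two_ne_zero]
  simp only [coe_symmSingle, star_one, mul_add, add_mul, single_mul_single_same, one_mul, mul_one,
    two_smul K, Submodule.coe_add]
  abel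

theorem diag_one_mul_offDiag {i j : Fin n} (hij : i ≠ j) (x : OctonionAlgebra K a b c) :
    symmSingle i i 1 * symmSingle i j x = symmSingle i j x := by
  refine Subtype.ext ?_
  rw [coe_mul, inv_smul_eq_iff₀ two_ne_zero]
  simp only [coe_symmSingle, star_one, mul_add, add_mul, single_mul_single_same, one_mul, mul_one,
    ne_eq, hij, hij.symm, not_false_eq_true, single_mul_single_of_ne, add_zero, zero_add,
    two_smul K]
  abel

variable {φ : LinearMap.BilinForm K (hermitianOct K a b c n)}

theorem apply_symmSingle_of_ne (hφ : IsSymmAssocForm φ) {i k l : Fin n} (hik : i ≠ k)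
    (hil : i ≠ l) (j : Fin n) (x y : OctonionAlgebra K a b c) :
    φ (symmSingle i j x) (symmSingle k l y) = 0 := by
  have h : φ (symmSingle i i 1 * symmSingle i j x) (symmSingle k l y) = 0 := by
    rw [jordan_comm, hφ.2, diag_one_mul_of_ne hik hil, map_zero]
  obtain rfl | hij := eq_or_ne i j
  · rw [diag_one_mul_diag] at h
    simpa [two_ne_zero] using h
  · rwa [diag_one_mul_offDiag hij] at h

theorem apply_offDiag (hφ : IsSymmAssocForm φ) {i j : Fin n} (hij : i ≠ j)
    (x y : OctonionAlgebra K a b c) :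
    φ (symmSingle i j x) (symmSingle i j y) =
      2⁻¹ * ((x * star y).1.re * φ (symmSingle i i 1) (symmSingle i i 1)) := by
  rw [← diag_one_mul_offDiag hij y, jordan_comm, ← hφ.2, symmSingle_mul_symmSingle_of_ne hij,
    symmSingle_self i, map_smul, map_add, LinearMap.smul_apply, LinearMap.add_apply,
    apply_symmSingle_of_ne hφ hij.symm hij.symm, add_zero, map_smul, LinearMap.smul_apply,
    smul_eq_mul, smul_eq_mul]

theorem apply_diag_one_eq (hφ : IsSymmAssocForm φ) (i j : Fin n) :
    φ (symmSingle i i 1) (symmSingle i i 1) = φ (symmSingle j j 1) (symmSingle j j 1) := by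
  obtain rfl | hij := eq_or_ne i j
  · rfl
  have h := apply_offDiag hφ hij 1 1
  rw [symmSingle_swap i j, star_one, apply_offDiag hφ hij.symm] at h
  simpa [two_ne_zero] using h.symm

theorem eq_zero_of_apply_diag_one (hφ : IsSymmAssocForm φ) (k : Fin n)
    (hk : φ (symmSingle k k 1) (symmSingle k k 1) = 0) : φ = 0 := by
  refine bilinForm_eq_zero_of_blocks iSup_range_symmSingle
    (fun i j x => ⟨_, symmSingle_swap i j x⟩) hφ.1 (apply_symmSingle_of_ne hφ) fun i j x y => ?_
  have hi : φ (symmSingle i i 1) (symmSingle i i 1) = 0 := (apply_diag_one_eq hφ i k).trans hk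
  obtain rfl | hij := eq_or_ne i j
  · rw [symmSingle_self i x, symmSingle_self i y]
    simp only [map_smul, LinearMap.smul_apply, hi, smul_zero]
  · rw [apply_offDiag hφ hij, hi, mul_zero, mul_zero]

theorem exists_eq_smul_traceBilinForm (hφ : IsSymmAssocForm φ) :
    ∃ t : K, φ = t • (traceBilinForm K a b c n).restrict (hermitianOct K a b c n) := by
  obtain _ | n := n
  · exact ⟨0, LinearMap.ext fun X => by rw [Subsingleton.elim X 0, map_zero, map_zero]⟩
  · exact hφ.exists_eq_smul isSymmAssocForm_traceBilinForm
      ((traceBilinForm_diag_one 0).trans_ne (pow_ne_zero 3 two_ne_zero))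
      fun _ hχ => eq_zero_of_apply_diag_one hχ 0

end hermitianOct

namespace skewHermitianOct

variable {K : Type*} [Field K] {a b c : K} {n : ℕ}

theorem coe_mul (X Y : skewHermitianOct K a b c n) :
    ((X * Y : skewHermitianOct K a b c n) : OctonionMatrix K a b c n) =
      X.1 * Y.1 - Y.1 * X.1 := rfl

theorem commutator_antisymm (X Y : skewHermitianOct K a b c n) : X * Y = -(Y * X) :=
  Subtype.ext <| by rw [coe_mul, Submodule.coe_neg, coe_mul, neg_sub]

theorem isSymmAssocForm_traceBilinForm :
    IsSymmAssocForm ((traceBilinForm K a b c n).restrict (skewHermitianOct K a b c n)) :=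
  OctonionMatrix.isSymmAssocForm_traceBilinForm.restrict_of_coe_mul _ 1 (-1) fun X Y => by
    rw [coe_mul, one_smul, neg_one_smul, sub_eq_add_neg]

/-- The skew-Hermitian matrix `x Eᵢⱼ - x̄ Eⱼᵢ`. For `i = j` this is `(x - x̄) Eᵢᵢ`. -/
def skewSingle (i j : Fin n) : OctonionAlgebra K a b c →ₗ[K] skewHermitianOct K a b c n where
  toFun x := ⟨single i j x - single j i (star x), by
    change conjTranspose _ = _
    rw [conjTranspose_sub, conjTranspose_single, conjTranspose_single, star_star, neg_sub]⟩
  map_add' x y := Subtype.ext <| by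
    simp only [single_add, star_add, AddMemClass.mk_add_mk]
    abel
  map_smul' t x := Subtype.ext <| by
    simp [star_smul', smul_single, smul_sub]

theorem coe_skewSingle (i j : Fin n) (x : OctonionAlgebra K a b c) :
    (skewSingle i j x : OctonionMatrix K a b c n) = single i j x - single j i (star x) := rfl

theorem coe_skewSingle_self (i : Fin n) (x : OctonionAlgebra K a b c) :
    (skewSingle i i x : OctonionMatrix K a b c n) = single i i (x - star x) :=
  (matrixSingle_sub i i x (star x)).symm

theorem skewSingle_swap (i j : Fin n) (x : OctonionAlgebra K a b c) :
    skewSingle i j x = skewSingle j i (-star x) :=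
  Subtype.ext <| by
    rw [map_neg, Submodule.coe_neg, coe_skewSingle, coe_skewSingle, star_star, neg_sub]

theorem skewSingle_self_one (i : Fin n) : skewSingle i i (1 : OctonionAlgebra K a b c) = 0 :=
  Subtype.ext <| by rw [coe_skewSingle, star_one, sub_self, Submodule.coe_zero]

theorem sum_skewSingle (X : skewHermitianOct K a b c n) :
    ∑ i, ∑ j, skewSingle i j (X.1 i j) = (2 : K) • X := by
  have hX : X.1.conjTranspose = -X.1 := X.2
  refine Subtype.ext ?_
  simp only [Submodule.coe_smul, Submodule.coe_sum, coe_skewSingle, Finset.sum_sub_distrib]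
  rw [← conjTranspose_eq_sum_single, ← matrix_eq_sum_single, hX, sub_neg_eq_add, two_smul]

theorem diag_mul_diag (i : Fin n) (x y : OctonionAlgebra K a b c) :
    skewSingle i i x * skewSingle i i y = (2 : K) • skewSingle i i ⁅x, y⁆ := by
  refine Subtype.ext ?_
  rw [coe_mul, Submodule.coe_smul, coe_skewSingle_self, coe_skewSingle_self, coe_skewSingle_self,
    single_mul_single_same, single_mul_single_same, smul_single, ← lie_sub_star_sub_star,
    Ring.lie_def, matrixSingle_sub]

theorem diag_mul_offDiag {i j : Fin n} (hij : i ≠ j) (x y : OctonionAlgebra K a b c) :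
    skewSingle i i x * skewSingle i j y = skewSingle i j ((x - star x) * y) := by
  refine Subtype.ext ?_
  rw [coe_mul, coe_skewSingle_self, coe_skewSingle, coe_skewSingle]
  simp only [matrixSingle_sub, mul_sub, sub_mul, single_mul_single_same, ne_eq, hij, hij.symm,
    not_false_eq_true, single_mul_single_of_ne, star_sub, star_mul, star_star]
  abel

theorem offDiag_mul_diag {i j : Fin n} (hij : i ≠ j) (x y : OctonionAlgebra K a b c) :
    skewSingle i j x * skewSingle j j y = skewSingle i j (x * (y - star y)) := by
  refine Subtype.ext ?_
  rw [coe_mul, coe_skewSingle_self, coe_skewSingle, coe_skewSingle]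
  simp [mul_sub, sub_mul, hij, hij.symm, matrixSingle_sub]

theorem offDiag_mul_offDiag {i j : Fin n} (hij : i ≠ j) (x y : OctonionAlgebra K a b c) :
    skewSingle i j x * skewSingle i j y =
      skewSingle i i (y * star x) + skewSingle j j (star y * x) := by
  refine Subtype.ext ?_
  simp only [coe_mul, coe_skewSingle, mul_sub, sub_mul, ne_eq, hij, hij.symm, not_false_eq_true,
    single_mul_single_of_ne, single_mul_single_same, Submodule.coe_add, star_mul, star_star]
  abel

theorem diag_mul_of_ne {i k l : Fin n} (hik : i ≠ k) (hil : i ≠ l)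
    (x y : OctonionAlgebra K a b c) : skewSingle i i x * skewSingle k l y = 0 := by
  refine Subtype.ext ?_
  simp [coe_mul, coe_skewSingle, sub_mul, mul_sub, hik, hil, hik.symm, hil.symm]

theorem diag_imI_mul_offDiag {i j : Fin n} (hij : i ≠ j) (x : OctonionAlgebra K a b c) :
    skewSingle i i (imI K a b c) * skewSingle i j (imI K a b c * x) =
      (2 * a) • skewSingle i j x := by
  rw [diag_mul_offDiag hij, imI_sub_star_imI, smul_mul_assoc, imI_mul_imI_mul, smul_smul, map_smul]

theorem traceBilinForm_diag_imI (i : Fin n) :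
    (traceBilinForm K a b c n).restrict (skewHermitianOct K a b c n)
      (skewSingle i i (imI K a b c)) (skewSingle i i (imI K a b c)) = 2 ^ 3 * a := by
  rw [LinearMap.BilinForm.restrict_apply, LinearMap.domRestrict_apply, traceBilinForm_apply,
    coe_skewSingle_self, single_mul_single_same, trace_single_eq_same, tr_apply, imI_sub_star_imI]
  simp only [fst_mul, fst_smul, snd_smul, fst_imI, snd_imI, QuaternionAlgebra.smul_mk, smul_eq_mul,
    mul_zero, mul_one, QuaternionAlgebra.mk_mul_mk, QuaternionAlgebra.re_add, smul_zero,
    QuaternionAlgebra.re_zero]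
  ring

variable {φ : LinearMap.BilinForm K (skewHermitianOct K a b c n)}

theorem apply_offDiag (hφ : IsSymmAssocForm φ) {i j : Fin n} (hij : i ≠ j)
    (x : OctonionAlgebra K a b c) (Y : skewHermitianOct K a b c n) :
    2 * a * φ (skewSingle i j x) Y =
      -φ (skewSingle i j (imI K a b c * x)) (skewSingle i i (imI K a b c) * Y) := by
  rw [← hφ.2, commutator_antisymm, diag_imI_mul_offDiag hij, map_neg, LinearMap.neg_apply,
    neg_neg, map_smul, LinearMap.smul_apply, smul_eq_mul]

variable [NeZero (2 : K)]

theorem iSup_range_skewSingle :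
    ⨆ i, ⨆ j, LinearMap.range
      (skewSingle i j : OctonionAlgebra K a b c →ₗ[K] skewHermitianOct K a b c n) = ⊤ := by
  refine eq_top_iff.2 fun X _ => ?_
  rw [← inv_smul_smul₀ (two_ne_zero' K) X, ← sum_skewSingle]
  exact Submodule.smul_mem _ _ <| Submodule.sum_mem _ fun i _ => Submodule.sum_mem _ fun j _ =>
    Submodule.mem_iSup_of_mem i <| Submodule.mem_iSup_of_mem j ⟨_, rfl⟩

theorem apply_skewSingle_of_ne (hφ : IsSymmAssocForm φ) (ha : a ≠ 0) (hb : b ≠ 0)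
    {i k l : Fin n} (hik : i ≠ k) (hil : i ≠ l) (j : Fin n) (x y : OctonionAlgebra K a b c) :
    φ (skewSingle i j x) (skewSingle k l y) = 0 := by
  obtain rfl | hij := eq_or_ne i j
  · have h : φ.flip (skewSingle k l y) ∘ₗ skewSingle i i = 0 := by
      refine linearMap_eq_zero_of_lie ha hb ?_ fun x₁ x₂ => ?_
      · simp [skewSingle_self_one]
      · have h := hφ.2 (skewSingle i i x₁) (skewSingle i i x₂) (skewSingle k l y)
        rw [diag_mul_diag, diag_mul_of_ne hik hil] at h
        simpa [two_ne_zero] using h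
    exact LinearMap.congr_fun h x
  · have h := apply_offDiag hφ hij x (skewSingle k l y)
    rw [diag_mul_of_ne hik hil] at h
    simpa [ha, two_ne_zero] using h

theorem apply_diag_eq_apply_offDiag (hφ : IsSymmAssocForm φ) (ha : a ≠ 0) (hb : b ≠ 0)
    {i j : Fin n} (hij : i ≠ j) (x y : OctonionAlgebra K a b c) :
    φ (skewSingle j j x) (skewSingle j j y) =
      φ (skewSingle i j x) (skewSingle i j (y - star y)) := by
  have h := hφ.2 (skewSingle i j x) (skewSingle i j 1) (skewSingle j j y)
  rwa [offDiag_mul_offDiag hij, star_one, one_mul, one_mul, offDiag_mul_diag hij, one_mul, map_add,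
    LinearMap.add_apply, apply_skewSingle_of_ne hφ ha hb hij hij, zero_add] at h

theorem apply_diag_eq_zero (hφ : IsSymmAssocForm φ) (ha : a ≠ 0) {k : Fin n}
    (hk : φ (skewSingle k k (imI K a b c)) (skewSingle k k (imI K a b c)) = 0)
    (x y : OctonionAlgebra K a b c) : φ (skewSingle k k x) (skewSingle k k y) = 0 := by
  have h : φ.compl₁₂ (skewSingle k k) (skewSingle k k) = 0 := by
    refine bilinForm_eq_zero_of_lie ha (fun x y => hφ.1 _ _) (fun x y z => ?_) (fun y => ?_) hk
    · have h := hφ.2 (skewSingle k k x) (skewSingle k k y) (skewSingle k k z)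
      rw [diag_mul_diag, diag_mul_diag] at h
      simpa [two_ne_zero] using h
    · simp [skewSingle_self_one]
  exact LinearMap.congr_fun₂ h x y

theorem apply_offDiag_eq_zero (hφ : IsSymmAssocForm φ) (ha : a ≠ 0) (hb : b ≠ 0) {i j : Fin n}
    (hij : i ≠ j) (hi : φ (skewSingle i i (imI K a b c)) (skewSingle i i (imI K a b c)) = 0)
    (x y : OctonionAlgebra K a b c) : φ (skewSingle i j x) (skewSingle i j y) = 0 := by
  have h := hφ.2 (skewSingle i j y) (skewSingle i j (imI K a b c * x))
    (skewSingle i i (imI K a b c))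
  rw [offDiag_mul_offDiag hij, map_add, LinearMap.add_apply, apply_diag_eq_zero hφ ha hi,
    apply_skewSingle_of_ne hφ ha hb hij.symm hij.symm, commutator_antisymm,
    diag_imI_mul_offDiag hij, hφ.1 _ (-_)] at h
  simpa [ha, two_ne_zero] using h

theorem eq_zero_of_apply_diag_imI (hφ : IsSymmAssocForm φ) (ha : a ≠ 0) (hb : b ≠ 0) (k : Fin n)
    (hk : φ (skewSingle k k (imI K a b c)) (skewSingle k k (imI K a b c)) = 0) : φ = 0 := by
  have hdiag (i : Fin n) (x y : OctonionAlgebra K a b c) :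
      φ (skewSingle i i x) (skewSingle i i y) = 0 := by
    obtain rfl | hki := eq_or_ne k i
    · exact apply_diag_eq_zero hφ ha hk x y
    · rw [apply_diag_eq_apply_offDiag hφ ha hb hki, apply_offDiag_eq_zero hφ ha hb hki hk]
  refine bilinForm_eq_zero_of_blocks iSup_range_skewSingle
    (fun i j x => ⟨_, skewSingle_swap i j x⟩) hφ.1 (apply_skewSingle_of_ne hφ ha hb)
    fun i j x y => ?_
  obtain rfl | hij := eq_or_ne i j
  · exact hdiag i x y
  · exact apply_offDiag_eq_zero hφ ha hb hij (hdiag i _ _) x y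

theorem exists_eq_smul_traceBilinForm (hφ : IsSymmAssocForm φ) (ha : a ≠ 0) (hb : b ≠ 0) :
    ∃ t : K, φ = t • (traceBilinForm K a b c n).restrict (skewHermitianOct K a b c n) := by
  obtain _ | n := n
  · exact ⟨0, LinearMap.ext fun X => by rw [Subsingleton.elim X 0, map_zero, map_zero]⟩
  · exact hφ.exists_eq_smul isSymmAssocForm_traceBilinForm
      ((traceBilinForm_diag_imI 0).trans_ne (mul_ne_zero (pow_ne_zero 3 two_ne_zero) ha))
      fun _ hχ => eq_zero_of_apply_diag_imI hχ ha hb 0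

end skewHermitianOct

theorem theorem3_general (K : Type*) [Field K] (h2 : (2 : K) ≠ 0)
    (a b c : K) (ha : a ≠ 0) (hb : b ≠ 0) (n : ℕ) :
    (∃ B : LinearMap.BilinForm K (hermitianOct K a b c n),
      (∀ X Y : hermitianOct K a b c n,
        B X Y • (1 : OctonionAlgebra K a b c) = OctonionMatrix.traceForm X.1 Y.1) ∧
      IsSymmAssocForm B ∧
      ∀ φ : LinearMap.BilinForm K (hermitianOct K a b c n),
        IsSymmAssocForm φ → ∃ t : K, φ = t • B) ∧
    (∃ B : LinearMap.BilinForm K (skewHermitianOct K a b c n),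
      (∀ X Y : skewHermitianOct K a b c n,
        B X Y • (1 : OctonionAlgebra K a b c) = OctonionMatrix.traceForm X.1 Y.1) ∧
      IsSymmAssocForm B ∧
      ∀ φ : LinearMap.BilinForm K (skewHermitianOct K a b c n),
        IsSymmAssocForm φ → ∃ t : K, φ = t • B) := by
  have : NeZero (2 : K) := ⟨h2⟩
  exact ⟨⟨_, fun X Y => traceBilinForm_smul_one X.1 Y.1,
      hermitianOct.isSymmAssocForm_traceBilinForm,
      fun _ hφ => hermitianOct.exists_eq_smul_traceBilinForm hφ⟩,
    ⟨_, fun X Y => traceBilinForm_smul_one X.1 Y.1,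
      skewHermitianOct.isSymmAssocForm_traceBilinForm,
      fun _ hφ => skewHermitianOct.exists_eq_smul_traceBilinForm hφ ha hb⟩⟩

theorem theorem3 (K : Type*) [Field K] (h2 : (2 : K) ≠ 0) (h3 : (3 : K) ≠ 0)
    (a b c : K) (ha : a ≠ 0) (hb : b ≠ 0) (hc : c ≠ 0) (n : ℕ) :
    (∃ B : LinearMap.BilinForm K (hermitianOct K a b c n),
      (∀ X Y : hermitianOct K a b c n,
        B X Y • (1 : OctonionAlgebra K a b c) = OctonionMatrix.traceForm X.1 Y.1) ∧
      IsSymmAssocForm B ∧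
      ∀ φ : LinearMap.BilinForm K (hermitianOct K a b c n),
        IsSymmAssocForm φ → ∃ t : K, φ = t • B) ∧
    (∃ B : LinearMap.BilinForm K (skewHermitianOct K a b c n),
      (∀ X Y : skewHermitianOct K a b c n,
        B X Y • (1 : OctonionAlgebra K a b c) = OctonionMatrix.traceForm X.1 Y.1) ∧
      IsSymmAssocForm B ∧
      ∀ φ : LinearMap.BilinForm K (skewHermitianOct K a b c n),
        IsSymmAssocForm φ → ∃ t : K, φ = t • B) :=
  theorem3_general K h2 a b c ha hb n
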